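/- For a finite set $V\subset\mathbb{R}^d$ and an integer $1\le k\le d$, let $f_k(V)$ be the maximum, over all $k$-element subsets $S\subseteq V$, of $\det\big(\langle u,v\rangle\big)_{u,v\in S}$ (with $f_k(V)=0$ if $|V|<k$). A map $c$ sending every finite set $V\subset\mathbb{R}^d$ to a subset $c(V)\subseteq V$ is an $\alpha$-composable core-set ($\alpha>0$) of size at most $t$ for $k$-determinant maximization if $|c(V)|\le t$ for every $V$ and $$f_k\big(c(V_1)\cup\dots\cup c(V_p)\big)\ \ge\ \frac1\alpha\, f_k(V_1\cup\dots\cup V_p)$$ for every finite collection of finite sets $V_1,\dots,V_p\subset\mathbb{R}^d$. \textbf{Theorem.} There are real numbers $\varepsilon(\beta,k)$, for real $\beta\ge1$ and integers $k\ge1$, such that $\varepsilon(\beta,k)\to0$ as $k\to\infty$ for every fixed $\beta\ge1$, and even $\sup_{1\le\beta\le k^{1-\eta}}|\varepsilon(\beta,k)|\to0$ as $k\to\infty$ for every fixed $\eta\in(0,1)$, with the following property. For all real $\beta\ge 1$, all integers $d\ge k\ge 1$, every $\alpha>0$ and every $\alpha$-composable core-set of size at most $k^{\beta}$ for $k$-determinant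 maximization in $\mathbb{R}^d$, $$\alpha\ \ge\ \Big(\frac{k}{\beta}\Big)^{k\,(1-\varepsilon(\beta,k))}.$$ -/

import Mathlib

open Filter Topology

open Classical in
/-- The determinant of the Gram matrix `(⟪u, v⟫)` with rows and columns indexed by the vectors of
the finite set `S`, i.e. the squared volume of the parallelepiped spanned by `S`. -/
noncomputable def gramDet {d : ℕ} (S : Finset (EuclideanSpace ℝ (Fin d))) : ℝ :=
  (Matrix.gram ℝ (fun v : S => (v : EuclideanSpace ℝ (Fin d)))).det

/-- The optimal value of the `k`-determinant maximization problem on the finite set `V`: the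
largest Gram determinant of a `k`-element subset of `V`. The supremum is over a finite set of
nonnegative numbers; it is `0` when `V` has fewer than `k` elements (`sSup ∅ = 0`). -/
noncomputable def detMaxValue {d : ℕ} (k : ℕ) (V : Finset (EuclideanSpace ℝ (Fin d))) : ℝ :=
  sSup (gramDet '' {S : Finset (EuclideanSpace ℝ (Fin d)) | S ⊆ V ∧ S.card = k})

open Classical in
/-- `c` is an `α`-composable core-set for maximization of the set function `f`: it maps each finite
set of vectors to one of its subsets and, for all finite sets `V₁, …, V_p`,
`f (c V₁ ∪ ⋯ ∪ c V_p) ≥ (1 / α) f (V₁ ∪ ⋯ ∪ V_p)`. -/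
def IsComposableCoreset {d : ℕ} (f : Finset (EuclideanSpace ℝ (Fin d)) → ℝ) (α : ℝ)
    (c : Finset (EuclideanSpace ℝ (Fin d)) → Finset (EuclideanSpace ℝ (Fin d))) : Prop :=
  0 < α ∧ (∀ V, c V ⊆ V) ∧
    ∀ (p : ℕ) (V : Fin p → Finset (EuclideanSpace ℝ (Fin d))),
      (1 / α) * f (Finset.univ.biUnion V) ≤ f (Finset.univ.biUnion fun i => c (V i))

/-- The core-set function `c` has size at most `t`: every core-set it returns has at most `t`
elements. -/
def CoresetSizeLE {d : ℕ}
    (c : Finset (EuclideanSpace ℝ (Fin d)) → Finset (EuclideanSpace ℝ (Fin d))) (t : ℝ) : Prop :=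
  ∀ V, ((c V).card : ℝ) ≤ t

/-! The adversary builds an orthonormal basis `v` of a `k`-dimensional space greedily. In the
current space `W`, of dimension `n`, random signs give more than `t` unit vectors with pairwise
inner products at most `r n`, where `r n ^ 2` is about `log t / n`. A core-set of size `t` drops one
of them; call it `v i`, scale the whole family by `M ^ i`, and pass to the orthogonal complement of
`v i` in `W`. When `n` is too small for this, `r n = 1` and nothing is gained.

The union of the families contains all `M ^ i • v i`, so its optimum is at least `∏ M ^ (2 * i)`. A
vector kept from family `i` has no coordinate before `i` and coordinate at most `M ^ i * r (k - i)`
at `i`. Its later coordinates may be as large as `M ^ i`, which is small against the scale `M ^ l`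
of a later family. In the Leibniz expansion every term but one therefore loses a factor `M`. Letting
`M → ∞` gives `1 / α ≤ ∏ r n ^ 2` (`one_div_le_prod_sq`). With `r n ^ 2 ≤ q / n` and `q = 6 β log k`
this is at most `q ^ k / k! ≤ (e q / k) ^ k`. -/

/-! ### Sign vectors with small correlations -/

/-- The sign `±1` encoded by a Boolean. -/
noncomputable def boolSign (b : Bool) : ℝ := if b then 1 else -1

lemma boolSign_mul_self (b : Bool) : boolSign b * boolSign b = 1 := by
  cases b <;> simp [boolSign]

/-- The correlation `∑ᵢ xᵢ yᵢ` of two sign vectors. -/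
noncomputable def signCorr {n : ℕ} (x y : Fin n → Bool) : ℝ :=
  ∑ i, boolSign (x i) * boolSign (y i)

lemma signCorr_self {n : ℕ} (x : Fin n → Bool) : signCorr x x = n := by
  simp [signCorr, boolSign_mul_self]

lemma signCorr_comm {n : ℕ} (x y : Fin n → Bool) : signCorr x y = signCorr y x := by
  simp [signCorr, mul_comm]

/-- The exponential factors over coordinates, and each factor sums to `exp a + exp (-a)` whatever
the sign `x i` is. -/
lemma sum_exp_mul_signCorr {n : ℕ} (x : Fin n → Bool) (a : ℝ) :
    ∑ y : Fin n → Bool, Real.exp (a * signCorr x y) = (2 * Real.cosh a) ^ n := by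
  have h1 : ∀ y : Fin n → Bool, Real.exp (a * signCorr x y)
      = ∏ i, Real.exp (a * (boolSign (x i) * boolSign (y i))) := by
    intro y
    rw [signCorr, Finset.mul_sum, Real.exp_sum]
  have h2 : ∀ b : Bool, ∑ b' : Bool, Real.exp (a * (boolSign b * boolSign b'))
      = 2 * Real.cosh a := by
    intro b
    rw [Real.cosh_eq]
    cases b <;> simp [boolSign] <;> ring
  simp_rw [h1]
  rw [← Fintype.prod_sum (fun i b' => Real.exp (a * (boolSign (x i) * boolSign b')))]
  rw [Finset.prod_congr rfl fun i _ => h2 (x i)]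
  simp

/-- Hoeffding's inequality for the correlation with a fixed sign vector, in counting form. -/
lemma card_lt_abs_signCorr_le {n : ℕ} (x : Fin n → Bool) {r : ℝ} (hr : 0 ≤ r) :
    ((Finset.univ.filter fun y => n * r < |signCorr x y|).card : ℝ)
      ≤ 2 * 2 ^ n * Real.exp (-(n * r ^ 2 / 2)) := by
  classical
  -- Chernoff bound; the exponential parameter `r` is the optimal one for the estimate `cosh r ≤ exp
  -- (r ^ 2 / 2)`.
  have key : ((Finset.univ.filter fun y => n * r < |signCorr x y|).card : ℝ)
      * Real.exp (r * (n * r)) ≤ 2 * (2 * Real.cosh r) ^ n := by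
    calc ((Finset.univ.filter fun y => n * r < |signCorr x y|).card : ℝ) * Real.exp (r * (n * r))
        = ∑ y ∈ Finset.univ.filter fun y => n * r < |signCorr x y|,
            Real.exp (r * (n * r)) := by simp
      _ ≤ ∑ y ∈ Finset.univ.filter fun y => n * r < |signCorr x y|,
            (Real.exp (r * signCorr x y) + Real.exp (-r * signCorr x y)) := by
          refine Finset.sum_le_sum fun y hy => ?_
          have hy' := (Finset.mem_filter.1 hy).2
          rcases abs_cases (signCorr x y) with ⟨h, -⟩ | ⟨h, -⟩ <;> rw [h] at hy'
          · have : Real.exp (r * (n * r)) ≤ Real.exp (r * signCorr x y) := by gcongr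
            linarith [Real.exp_pos (-r * signCorr x y)]
          · have : Real.exp (r * (n * r)) ≤ Real.exp (-r * signCorr x y) := by
              rw [neg_mul, ← mul_neg]; gcongr
            linarith [Real.exp_pos (r * signCorr x y)]
      _ ≤ ∑ y, (Real.exp (r * signCorr x y) + Real.exp (-r * signCorr x y)) :=
          Finset.sum_le_sum_of_subset_of_nonneg (Finset.subset_univ _)
            fun _ _ _ => by positivity
      _ = 2 * (2 * Real.cosh r) ^ n := by
          rw [Finset.sum_add_distrib, sum_exp_mul_signCorr, sum_exp_mul_signCorr, Real.cosh_neg]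
          ring
  have h2 : 2 * (2 * Real.cosh r) ^ n ≤ 2 * 2 ^ n * Real.exp (n * (r ^ 2 / 2)) := by
    rw [mul_pow, Real.exp_nat_mul, mul_assoc]
    have := Real.cosh_le_exp_half_sq r
    have := Real.cosh_pos r
    gcongr
  rw [← mul_le_mul_iff_left₀ (Real.exp_pos (r * (n * r)))]
  refine (key.trans h2).trans_eq ?_
  rw [mul_assoc (2 * 2 ^ n) _ (Real.exp (r * (n * r))), ← Real.exp_add]
  congr 2
  ring

/-- The Gilbert–Varshamov argument: there are many sign vectors with small pairwise correlations. -/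
lemma exists_signVectors {n : ℕ} {r t : ℝ} (hn : 0 < n) (hr : 0 ≤ r) (hr1 : r < 1)
    (ht : 2 * t < Real.exp (n * r ^ 2 / 2)) :
    ∃ G : Finset (Fin n → Bool), t < G.card ∧
      ∀ x ∈ G, ∀ y ∈ G, x ≠ y → |signCorr x y| ≤ n * r := by
  classical
  let P : Finset (Fin n → Bool) → Prop := fun G =>
    ∀ x ∈ G, ∀ y ∈ G, x ≠ y → |signCorr x y| ≤ n * r
  obtain ⟨G, hG, hmax⟩ := Finset.exists_max_image (Finset.univ.filter P) Finset.card
    ⟨∅, by simp [P]⟩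
  have hG' : P G := (Finset.mem_filter.1 hG).2
  refine ⟨G, ?_, hG'⟩
  -- A vector outside all these neighbourhoods could be added to `G`, against maximality; `r < 1`
  -- makes each vector lie in its own neighbourhood.
  have hcover : (Finset.univ : Finset (Fin n → Bool)) ⊆
      G.biUnion fun x => Finset.univ.filter fun y => n * r < |signCorr x y| := by
    intro y _
    by_contra hy
    simp only [Finset.mem_biUnion, Finset.mem_filter, Finset.mem_univ, true_and, not_exists,
      not_and, not_lt] at hy
    have hyG : y ∉ G := by
      intro h
      have h1 := hy y h
      rw [signCorr_self, Nat.abs_cast] at h1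
      have : (0 : ℝ) < n := by exact_mod_cast hn
      nlinarith
    have hP : P (insert y G) := by
      intro a ha b hb hab
      rcases Finset.mem_insert.1 ha with rfl | ha' <;> rcases Finset.mem_insert.1 hb with rfl | hb'
      · exact absurd rfl hab
      · rw [signCorr_comm]; exact hy b hb'
      · exact hy a ha'
      · exact hG' a ha' b hb' hab
    have := hmax (insert y G) (by simpa using hP)
    rw [Finset.card_insert_of_notMem hyG] at this
    omega
  have h1 : ((2 : ℝ) ^ n) ≤ G.card * (2 * 2 ^ n * Real.exp (-(n * r ^ 2 / 2))) := by
    have h := (Finset.card_le_card hcover).trans Finset.card_biUnion_le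
    have h' : ((Fintype.card (Fin n → Bool) : ℕ) : ℝ)
        ≤ ∑ x ∈ G, ((Finset.univ.filter fun y => n * r < |signCorr x y|).card : ℝ) := by
      exact_mod_cast h
    calc ((2 : ℝ) ^ n) = ((Fintype.card (Fin n → Bool) : ℕ) : ℝ) := by simp
      _ ≤ _ := h'
      _ ≤ ∑ x ∈ G, (2 * 2 ^ n * Real.exp (-(n * r ^ 2 / 2))) :=
          Finset.sum_le_sum fun x _ => card_lt_abs_signCorr_le x hr
      _ = _ := by simp
  have h2 : (1 : ℝ) ≤ G.card * 2 * Real.exp (-(n * r ^ 2 / 2)) := by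
    have h2n : (0 : ℝ) < 2 ^ n := by positivity
    rw [← mul_le_mul_iff_right₀ h2n]
    linarith
  rw [Real.exp_neg, ← div_eq_mul_inv, le_div_iff₀ (Real.exp_pos _)] at h2
  linarith

/-! ### The hard instance -/

/-- A finite-dimensional space contains many unit vectors with small pairwise inner products. -/
lemma exists_nearlyOrthonormal {X : Type*} [NormedAddCommGroup X] [InnerProductSpace ℝ X]
    (W : Submodule ℝ X) [FiniteDimensional ℝ W] {r t : ℝ} (hW : 0 < Module.finrank ℝ W)
    (hr : 0 ≤ r) (hr1 : r < 1) (ht : 2 * t < Real.exp (Module.finrank ℝ W * r ^ 2 / 2)) :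
    ∃ G : Finset X, t < G.card ∧ (∀ u ∈ G, u ∈ W ∧ ‖u‖ = 1) ∧
      ∀ u ∈ G, ∀ v ∈ G, u ≠ v → |inner ℝ u v| ≤ r := by
  classical
  set n := Module.finrank ℝ W with hn
  obtain ⟨G, hcard, hG⟩ := exists_signVectors hW hr hr1 ht
  have hn0 : (0 : ℝ) < n := by exact_mod_cast hW
  let b := stdOrthonormalBasis ℝ W
  let f : (Fin n → Bool) → X := fun x => ((√n)⁻¹ • ∑ i, boolSign (x i) • b i : W)
  have hinner : ∀ x y, inner ℝ (f x) (f y) = (n : ℝ)⁻¹ * signCorr x y := by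
    intro x y
    have : inner ℝ (f x) (f y) = inner ℝ ((√n)⁻¹ • ∑ i, boolSign (x i) • b i : W)
      ((√n)⁻¹ • ∑ i, boolSign (y i) • b i : W) := rfl
    rw [this, real_inner_smul_left, real_inner_smul_right, b.orthonormal.inner_sum, ← mul_assoc,
      ← mul_inv, Real.mul_self_sqrt hn0.le]
    simp only [conj_trivial]
    rfl
  have hnorm : ∀ x, ‖f x‖ = 1 := by
    intro x
    have h := hinner x x
    rw [signCorr_self, inv_mul_cancel₀ hn0.ne', real_inner_self_eq_norm_sq] at h
    exact (pow_eq_one_iff_of_nonneg (norm_nonneg _) two_ne_zero).1 h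
  have hcorr : ∀ x ∈ G, ∀ y ∈ G, x ≠ y → |inner ℝ (f x) (f y)| ≤ r := by
    intro x hx y hy hxy
    rw [hinner, abs_mul, abs_of_pos (inv_pos.2 hn0), inv_mul_le_iff₀ hn0]
    exact hG x hx y hy hxy
  have hinj : Set.InjOn f G := by
    intro x hx y hy hxy
    by_contra hne
    have h := hcorr x hx y hy hne
    rw [hxy, real_inner_self_eq_norm_sq, hnorm] at h
    norm_num at h
    linarith
  refine ⟨G.image f, by rwa [Finset.card_image_of_injOn hinj], ?_, ?_⟩
  · intro u hu
    obtain ⟨x, -, rfl⟩ := Finset.mem_image.1 hu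
    exact ⟨Subtype.coe_prop _, hnorm x⟩
  · intro u hu v hv huv
    obtain ⟨x, hx, rfl⟩ := Finset.mem_image.1 hu
    obtain ⟨y, hy, rfl⟩ := Finset.mem_image.1 hv
    exact hcorr x hx y hy fun h => huv (h ▸ rfl)

/-- In a positive-dimensional space, every core-set function of small size misses, on a suitable
finite set of vectors of norm at most `ρ`, a vector almost orthogonal to the core-set. -/
lemma exists_lost_vector {d : ℕ}
    (c : Finset (EuclideanSpace ℝ (Fin d)) → Finset (EuclideanSpace ℝ (Fin d)))
    (hc : ∀ V, c V ⊆ V) {t : ℝ} (hct : CoresetSizeLE c t)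
    (W : Submodule ℝ (EuclideanSpace ℝ (Fin d))) (hW : 0 < Module.finrank ℝ W) {ρ r : ℝ}
    (hρ : 0 < ρ) (hr : 0 ≤ r)
    (ht : 1 ≤ r ∨ 2 * t < Real.exp (Module.finrank ℝ W * r ^ 2 / 2)) :
    ∃ (v : EuclideanSpace ℝ (Fin d)) (V : Finset (EuclideanSpace ℝ (Fin d))),
      v ∈ W ∧ ‖v‖ = 1 ∧ ρ • v ∈ V ∧ (∀ u ∈ V, u ∈ W ∧ ‖u‖ ≤ ρ) ∧
      ∀ u ∈ c V, |inner ℝ u v| ≤ ρ * r := by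
  classical
  rcases le_or_gt 1 r with hr1 | hr1
  · have : Nontrivial W := Module.finrank_pos_iff.1 hW
    obtain ⟨w, hw⟩ := exists_norm_eq W (zero_le_one (α := ℝ))
    have hw' : ‖(w : EuclideanSpace ℝ (Fin d))‖ = 1 := hw
    refine ⟨w, {ρ • (w : EuclideanSpace ℝ (Fin d))}, w.2, hw', by simp, ?_, ?_⟩
    · intro u hu
      rw [Finset.mem_singleton.1 hu]
      exact ⟨W.smul_mem _ w.2, by rw [norm_smul, hw', Real.norm_of_nonneg hρ.le, mul_one]⟩
    · intro u hu
      rw [Finset.mem_singleton.1 (hc _ hu), real_inner_smul_left, real_inner_self_eq_norm_sq, hw',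
        abs_of_pos (by positivity)]
      nlinarith
  · obtain ⟨G, hcard, hG, hGr⟩ := exists_nearlyOrthonormal W hW hr hr1 (ht.resolve_left hr1.not_ge)
    have hinj : Function.Injective fun u : EuclideanSpace ℝ (Fin d) => ρ • u :=
      smul_right_injective _ hρ.ne'
    -- Pigeonhole: `G` has more than `t` elements, so the core-set cannot keep all of them.
    have hex : ∃ v ∈ G, ρ • v ∉ c (G.image (ρ • ·)) := by
      by_contra! h
      have h1 : G.image (ρ • ·) ⊆ c (G.image (ρ • ·)) := by
        intro u hu
        obtain ⟨x, hx, rfl⟩ := Finset.mem_image.1 hu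
        exact h x hx
      have h2 := Finset.card_le_card h1
      rw [Finset.card_image_of_injective _ hinj] at h2
      have h3 := hct (G.image (ρ • ·))
      have h4 : (G.card : ℝ) ≤ (c (G.image (ρ • ·))).card := by exact_mod_cast h2
      linarith
    obtain ⟨v, hvG, hv⟩ := hex
    refine ⟨v, G.image (ρ • ·), (hG v hvG).1, (hG v hvG).2, Finset.mem_image_of_mem _ hvG, ?_, ?_⟩
    · intro u hu
      obtain ⟨x, hx, rfl⟩ := Finset.mem_image.1 hu
      refine ⟨W.smul_mem _ (hG x hx).1, ?_⟩
      rw [norm_smul, (hG x hx).2, Real.norm_of_nonneg hρ.le, mul_one]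
    · intro u hu
      obtain ⟨x, hx, rfl⟩ := Finset.mem_image.1 (hc _ hu)
      have hne : x ≠ v := fun h => hv (h ▸ hu)
      rw [real_inner_smul_left, abs_mul, abs_of_pos hρ]
      exact mul_le_mul_of_nonneg_left (hGr x hx v hvG hne) hρ.le

/-- A hard instance: an orthonormal family `v`, each member of which is lost by the core-set
function on a set `V i` living, up to scale, in the orthogonal complement of its predecessors. -/
lemma exists_lost_orthonormal {d k : ℕ} (hkd : k ≤ d)
    (c : Finset (EuclideanSpace ℝ (Fin d)) → Finset (EuclideanSpace ℝ (Fin d)))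
    (hc : ∀ V, c V ⊆ V) {t : ℝ} (hct : CoresetSizeLE c t) {r : ℕ → ℝ} (hr : ∀ n, 0 ≤ r n)
    (ht : ∀ n : ℕ, 0 < n → 1 ≤ r n ∨ 2 * t < Real.exp (n * r n ^ 2 / 2)) {M : ℝ} (hM : 0 < M) :
    ∃ (v : Fin k → EuclideanSpace ℝ (Fin d)) (V : Fin k → Finset (EuclideanSpace ℝ (Fin d))),
      Orthonormal ℝ v ∧ (∀ i, M ^ (i : ℕ) • v i ∈ V i) ∧
      ∀ i, ∀ u ∈ V i, u ∈ Submodule.span ℝ (Set.range v) ∧ ‖u‖ ≤ M ^ (i : ℕ) ∧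
        (∀ l < i, inner ℝ u (v l) = 0) ∧
        (u ∈ c (V i) → |inner ℝ u (v i)| ≤ M ^ (i : ℕ) * r (k - i)) := by
  -- Stated for all `W`, with a junk value in dimension `0`, so that `choose` yields total functions
  -- to recurse on.
  have hstep : ∀ (i : ℕ) (W : Submodule ℝ (EuclideanSpace ℝ (Fin d))),
      ∃ (v : EuclideanSpace ℝ (Fin d)) (V : Finset (EuclideanSpace ℝ (Fin d))),
      0 < Module.finrank ℝ W →
      v ∈ W ∧ ‖v‖ = 1 ∧ M ^ i • v ∈ V ∧ (∀ u ∈ V, u ∈ W ∧ ‖u‖ ≤ M ^ i) ∧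
      ∀ u ∈ c V, |inner ℝ u v| ≤ M ^ i * r (Module.finrank ℝ W) := by
    intro i W
    by_cases hW : 0 < Module.finrank ℝ W
    · obtain ⟨v, V, h⟩ := exists_lost_vector c hc hct W hW (pow_pos hM i) (hr _) (ht _ hW)
      exact ⟨v, V, fun _ => h⟩
    · exact ⟨0, ∅, fun h => absurd h hW⟩
  choose v V hvV using hstep
  obtain ⟨E, hE⟩ : ∃ E : Submodule ℝ (EuclideanSpace ℝ (Fin d)), Module.finrank ℝ E = k := by
    obtain ⟨f, hf⟩ := exists_linearIndependent_of_le_finrank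
      (R := ℝ) (M := EuclideanSpace ℝ (Fin d)) (n := k) (by simpa using hkd)
    exact ⟨_, by simpa using finrank_span_eq_card hf⟩
  obtain ⟨W, hW0, hWsucc⟩ : ∃ W : ℕ → Submodule ℝ (EuclideanSpace ℝ (Fin d)),
      W 0 = E ∧ ∀ i, W (i + 1) = (ℝ ∙ v i (W i))ᗮ ⊓ W i :=
    ⟨fun i => Nat.rec E (fun i W => (ℝ ∙ v i W)ᗮ ⊓ W) i, rfl, fun _ => rfl⟩
  have hWanti : Antitone W := antitone_nat_of_succ_le fun i => by
    rw [hWsucc]; exact inf_le_right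
  have hfin : ∀ i, i ≤ k → Module.finrank ℝ (W i) = k - i := by
    intro i
    induction i with
    | zero => intro _; rw [hW0]; simpa using hE
    | succ i ih =>
      intro hi
      have h := ih (by omega)
      obtain ⟨h1, h2, -⟩ := hvV i (W i) (by omega)
      have hle : (ℝ ∙ v i (W i)) ≤ W i := by
        rwa [Submodule.span_singleton_le_iff_mem]
      have h3 := Submodule.finrank_add_inf_finrank_orthogonal hle
      have hne : v i (W i) ≠ 0 := by
        intro h0; rw [h0, norm_zero] at h2; exact zero_ne_one h2
      rw [finrank_span_singleton hne, ← hWsucc] at h3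
      omega
  have hprop : ∀ i : Fin k, _ := fun i => hvV i (W i) (by rw [hfin i i.2.le]; omega)
  have hperp : ∀ i l : ℕ, l < i → ∀ u ∈ W i, inner ℝ u (v l (W l)) = 0 := by
    intro i l hl u hu
    have h := hWanti (Nat.succ_le_of_lt hl) hu
    rw [Nat.succ_eq_add_one, hWsucc] at h
    rw [real_inner_comm]
    exact Submodule.mem_orthogonal_singleton_iff_inner_right.1 h.1
  have horth : Orthonormal ℝ fun i : Fin k => v i (W i) := by
    refine ⟨fun i => (hprop i).2.1, ?_⟩
    intro i j hij
    rcases lt_or_gt_of_ne hij with h | h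
    · have := hperp j i h _ (hprop j).1
      rwa [real_inner_comm] at this
    · exact hperp i j h _ (hprop i).1
  have hspan : Submodule.span ℝ (Set.range fun i : Fin k => v i (W i)) = E := by
    apply Submodule.eq_of_le_of_finrank_eq
    · rw [Submodule.span_le]
      rintro _ ⟨i, rfl⟩
      exact hW0 ▸ hWanti (Nat.zero_le _) (hprop i).1
    · rw [finrank_span_eq_card horth.linearIndependent, hE, Fintype.card_fin]
  refine ⟨fun i => v i (W i), fun i => V i (W i), horth, fun i => (hprop i).2.2.1, ?_⟩
  intro i u hu
  have hu' := (hprop i).2.2.2.1 u hu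
  refine ⟨?_, hu'.2, fun l hl => hperp i l hl u hu'.1, fun huc => ?_⟩
  · rw [hspan]; exact hW0 ▸ hWanti (Nat.zero_le _) hu'.1
  · have := (hprop i).2.2.2.2 u huc
    rwa [hfin i i.2.le] at this

/-! ### Determinant estimates -/

/-- The Gram determinant of `k` vectors in the span of an orthonormal `k`-family is the square of
the determinant of the coordinate matrix. -/
lemma gramDet_image_eq_sq {d k : ℕ} {v s : Fin k → EuclideanSpace ℝ (Fin d)}
    [DecidableEq (EuclideanSpace ℝ (Fin d))]
    (hv : Orthonormal ℝ v) (hs : Function.Injective s)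
    (hsv : ∀ a, s a ∈ Submodule.span ℝ (Set.range v)) :
    gramDet (Finset.univ.image s) = (Matrix.of fun a i => inner ℝ (s a) (v i)).det ^ 2 := by
  have hgram : Matrix.gram ℝ s = (Matrix.of fun a i => inner ℝ (s a) (v i)) *
      (Matrix.of fun a i => inner ℝ (s a) (v i)).transpose := by
    ext a b
    obtain ⟨x, hx⟩ := (Submodule.mem_span_range_iff_exists_fun ℝ).1 (hsv a)
    have hcoord : ∀ i, inner ℝ (s a) (v i) = x i := by
      intro i
      rw [← hx, hv.inner_left_fintype]
      simp
    simp only [Matrix.gram_apply, Matrix.mul_apply, Matrix.of_apply, Matrix.transpose_apply, hcoord]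
    rw [← hx, sum_inner]
    refine Finset.sum_congr rfl fun i _ => ?_
    rw [real_inner_smul_left, real_inner_comm]
  have hdet : gramDet (Finset.univ.image s) = (Matrix.gram ℝ s).det := by
    let e : Fin k ≃ (Finset.univ.image s : Finset (EuclideanSpace ℝ (Fin d))) :=
      Equiv.ofBijective (fun a => ⟨s a, Finset.mem_image_of_mem s (Finset.mem_univ a)⟩)
        ⟨fun a b hab => hs (congrArg Subtype.val hab), fun ⟨y, hy⟩ => by
          obtain ⟨a, -, rfl⟩ := Finset.mem_image.1 hy
          exact ⟨a, rfl⟩⟩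
    unfold gramDet
    have h : Matrix.gram ℝ s = (Matrix.gram ℝ fun v : (Finset.univ.image s :
        Finset (EuclideanSpace ℝ (Fin d))) => (v : EuclideanSpace ℝ (Fin d))).submatrix e e := rfl
    rw [h]
    convert (Matrix.det_submatrix_equiv_self e _).symm
  rw [hdet, hgram, Matrix.det_mul, Matrix.det_transpose, sq]

lemma gramDet_le_detMaxValue {d k : ℕ} {S V : Finset (EuclideanSpace ℝ (Fin d))} (hSV : S ⊆ V)
    (hS : S.card = k) : gramDet S ≤ detMaxValue k V := by
  refine le_csSup (Set.Finite.bddAbove (Set.Finite.image _ ?_)) ⟨S, ⟨hSV, hS⟩, rfl⟩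
  exact V.powerset.finite_toSet.subset fun T hT => by simpa using hT.1

/-- Leibniz bound for a matrix dominated by a scaled "triangular up to relabelling" matrix. -/
lemma abs_det_le_of_dominated {k : ℕ} (A : Matrix (Fin k) (Fin k) ℝ) (j : Fin k → Fin k)
    {M : ℝ} (hM : 1 ≤ M) {ρ : Fin k → ℝ} (hρ : ∀ i, 0 ≤ ρ i) (hρ1 : ∀ i, ρ i ≤ 1)
    (hlt : ∀ a i, i < j a → A a i = 0) (heq : ∀ a, |A a (j a)| ≤ M ^ (j a : ℕ) * ρ (j a))
    (hgt : ∀ a i, |A a i| ≤ M ^ (j a : ℕ)) :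
    |A.det| ≤ (∏ i : Fin k, M ^ (i : ℕ)) * (∏ i, ρ i + k.factorial / M) := by
  classical
  have hM0 : 0 < M := zero_lt_one.trans_le hM
  -- With `M ^ i` taken out of column `i`, an entry right of `j a` is at most `M ^ (j a) / M ^ i ≤ 1
  -- / M`. Only the permutation equal to `j`, if there is one, avoids such a factor.
  let B : Fin k → Fin k → ℝ := fun a i => if i = j a then ρ i else 1 / M
  have hB1 : ∀ a i, B a i ≤ 1 := by
    intro a i
    simp only [B]
    split_ifs
    · exact hρ1 i
    · rw [div_le_one hM0]; exact hM
  have hB0 : ∀ a i, 0 ≤ B a i := by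
    intro a i
    simp only [B]
    split_ifs
    · exact hρ i
    · positivity
  have hAB : ∀ a i, |A a i| ≤ M ^ (i : ℕ) * B a i := by
    intro a i
    rcases lt_trichotomy i (j a) with h | h | h
    · rw [hlt a i h, abs_zero]
      exact mul_nonneg (by positivity) (hB0 a i)
    · simp only [B, h, if_true]; exact heq a
    · simp only [B, h.ne', if_false]
      refine (hgt a i).trans ?_
      rw [mul_one_div, le_div_iff₀ hM0, ← pow_succ]
      exact pow_le_pow_right₀ hM h
  have hterm : ∀ σ : Equiv.Perm (Fin k), ∏ a, |A a (σ a)| ≤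
      (∏ i : Fin k, M ^ (i : ℕ)) * ((if ⇑σ = j then ∏ i, ρ i else 0) + 1 / M) := by
    intro σ
    have h1 : ∏ a, |A a (σ a)| ≤ (∏ i : Fin k, M ^ (i : ℕ)) * ∏ a, B a (σ a) := by
      rw [← Equiv.prod_comp σ fun i : Fin k => M ^ (i : ℕ), ← Finset.prod_mul_distrib]
      exact Finset.prod_le_prod (fun _ _ => abs_nonneg _) fun a _ => hAB a _
    refine h1.trans (mul_le_mul_of_nonneg_left ?_ (by positivity))
    split_ifs with hσ
    · have : ∏ a, B a (σ a) = ∏ i, ρ i := by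
        rw [← Equiv.prod_comp σ ρ]
        refine Finset.prod_congr rfl fun a _ => ?_
        simp [B, hσ]
      rw [this]
      have : 0 < 1 / M := by positivity
      linarith
    · obtain ⟨a, ha⟩ := Function.ne_iff.1 hσ
      rw [zero_add, ← Finset.mul_prod_erase _ _ (Finset.mem_univ a)]
      have h2 : B a (σ a) = 1 / M := by simp [B, ha]
      rw [h2]
      refine mul_le_of_le_one_right (by positivity) ?_
      exact Finset.prod_le_one (fun b _ => hB0 b _) fun b _ => hB1 b _
  calc |A.det| = |A.transpose.det| := by rw [Matrix.det_transpose]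
    _ ≤ ∑ σ : Equiv.Perm (Fin k), ∏ a, |A a (σ a)| := by
        rw [Matrix.det_apply]
        refine (Finset.abs_sum_le_sum_abs _ _).trans (Finset.sum_le_sum fun σ _ => ?_)
        rw [Units.smul_def, zsmul_eq_mul, abs_mul, Finset.abs_prod]
        rcases Int.units_eq_one_or (Equiv.Perm.sign σ) with h | h <;> simp [h]
    _ ≤ ∑ σ : Equiv.Perm (Fin k),
          (∏ i : Fin k, M ^ (i : ℕ)) * ((if ⇑σ = j then ∏ i, ρ i else 0) + 1 / M) :=
        Finset.sum_le_sum fun σ _ => hterm σ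
    _ ≤ (∏ i : Fin k, M ^ (i : ℕ)) * (∏ i, ρ i + k.factorial / M) := by
        rw [← Finset.mul_sum, Finset.sum_add_distrib]
        refine mul_le_mul_of_nonneg_left (add_le_add ?_ ?_) (by positivity)
        · have hρprod : 0 ≤ ∏ i, ρ i := Finset.prod_nonneg fun i _ => hρ i
          by_cases hex : ∃ σ : Equiv.Perm (Fin k), ⇑σ = j
          · obtain ⟨σ, hσ⟩ := hex
            rw [Finset.sum_eq_single σ]
            · simp [hσ]
            · intro τ _ hτ
              rw [if_neg]
              intro h
              exact hτ (DFunLike.coe_injective (h.trans hσ.symm))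
            · simp
          · push Not at hex
            simpa [hex] using hρprod
        · simp [Fintype.card_perm, div_eq_mul_inv]

/-! ### From the hard instance to bounds on `α` -/

/-- The loss of a composable core-set is at least the product of the losses forced in each
dimension. -/
theorem one_div_le_prod_sq {d k : ℕ} (hkd : k ≤ d)
    {c : Finset (EuclideanSpace ℝ (Fin d)) → Finset (EuclideanSpace ℝ (Fin d))} {α t : ℝ}
    (hc : IsComposableCoreset (detMaxValue k) α c) (hct : CoresetSizeLE c t) {r : ℕ → ℝ}
    (hr : ∀ n, 0 ≤ r n) (hr1 : ∀ n, r n ≤ 1)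
    (ht : ∀ n : ℕ, 0 < n → 1 ≤ r n ∨ 2 * t < Real.exp (n * r n ^ 2 / 2)) :
    1 / α ≤ (∏ i : Fin k, r (k - i)) ^ 2 := by
  classical
  obtain ⟨hα, hsub, hcomp⟩ := hc
  have main : ∀ M : ℝ, 1 ≤ M →
      1 / α ≤ (∏ i : Fin k, r (k - i) + k.factorial / M) ^ 2 := by
    intro M hM
    have hM0 : 0 < M := zero_lt_one.trans_le hM
    set T : ℝ := ∏ i : Fin k, M ^ (i : ℕ) with hT
    have hT0 : 0 < T := by positivity
    obtain ⟨v, V, hv, hvV, hV⟩ := exists_lost_orthonormal hkd c hsub hct hr ht hM0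
    have hlower : T ^ 2 ≤ detMaxValue k (Finset.univ.biUnion V) := by
      have hinj : Function.Injective fun i : Fin k => M ^ (i : ℕ) • v i := by
        intro a b hab
        by_contra hne
        have h1 : inner ℝ (M ^ (a : ℕ) • v a) (v b) = inner ℝ (M ^ (b : ℕ) • v b) (v b) :=
          congrArg (fun x : EuclideanSpace ℝ (Fin d) => inner ℝ x (v b)) hab
        rw [real_inner_smul_left, real_inner_smul_left, hv.2 hne, real_inner_self_eq_norm_sq,
          hv.1 b] at h1
        have : 0 < M ^ (b : ℕ) := by positivity
        norm_num at h1
        linarith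
      have hdet : gramDet (Finset.univ.image fun i : Fin k => M ^ (i : ℕ) • v i) = T ^ 2 := by
        rw [gramDet_image_eq_sq hv hinj fun a => (hV a _ (hvV a)).1]
        have : (Matrix.of fun a i : Fin k => inner ℝ (M ^ (a : ℕ) • v a) (v i))
            = Matrix.diagonal fun i : Fin k => M ^ (i : ℕ) := by
          ext a i
          rw [Matrix.of_apply, real_inner_smul_left, orthonormal_iff_ite.1 hv,
            Matrix.diagonal_apply]
          simp
        rw [this, Matrix.det_diagonal]
      rw [← hdet]
      refine gramDet_le_detMaxValue ?_ ?_
      · intro x hx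
        obtain ⟨i, -, rfl⟩ := Finset.mem_image.1 hx
        exact Finset.mem_biUnion.2 ⟨i, Finset.mem_univ _, hvV i⟩
      · rw [Finset.card_image_of_injective _ hinj, Finset.card_univ, Fintype.card_fin]
    have hupper : detMaxValue k (Finset.univ.biUnion fun i => c (V i)) ≤
        (T * (∏ i : Fin k, r (k - i) + k.factorial / M)) ^ 2 := by
      -- Nonnegativity of the bound covers the case of fewer than `k` kept vectors, where the
      -- supremum is `0`.
      refine Real.sSup_le ?_ (sq_nonneg _)
      rintro _ ⟨S, ⟨hS, hcard⟩, rfl⟩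
      let e := (S.equivFinOfCardEq hcard).symm
      let s : Fin k → EuclideanSpace ℝ (Fin d) := fun a => e a
      have hs : Function.Injective s := Subtype.val_injective.comp e.injective
      have himage : Finset.univ.image s = S := by
        apply Finset.eq_of_subset_of_card_le
        · intro x hx
          obtain ⟨a, -, rfl⟩ := Finset.mem_image.1 hx
          exact (e a).2
        · rw [Finset.card_image_of_injective _ hs, hcard, Finset.card_univ, Fintype.card_fin]
      have hmem : ∀ a, ∃ j, s a ∈ c (V j) := by
        intro a
        obtain ⟨j, -, hj⟩ := Finset.mem_biUnion.1 (hS (e a).2)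
        exact ⟨j, hj⟩
      choose j hj using hmem
      have hVs := fun a => hV (j a) (s a) (hsub _ (hj a))
      rw [← himage, gramDet_image_eq_sq hv hs fun a => (hVs a).1, ← sq_abs]
      refine pow_le_pow_left₀ (abs_nonneg _) ?_ 2
      refine abs_det_le_of_dominated _ j hM (ρ := fun i : Fin k => r (k - i)) (fun _ => hr _)
        (fun _ => hr1 _) (fun a i hi => (hVs a).2.2.1 i hi) (fun a => (hVs a).2.2.2 (hj a)) ?_
      intro a i
      refine (abs_real_inner_le_norm (s a) (v i)).trans ?_
      rw [hv.1 i, mul_one]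
      exact (hVs a).2.1
    have h := hcomp k V
    have h2 : 1 / α * T ^ 2 ≤ (∏ i : Fin k, r (k - i) + k.factorial / M) ^ 2 * T ^ 2 := by
      calc 1 / α * T ^ 2 ≤ 1 / α * detMaxValue k (Finset.univ.biUnion V) :=
            mul_le_mul_of_nonneg_left hlower (by positivity)
        _ ≤ _ := h.trans hupper
        _ = _ := by ring
    exact le_of_mul_le_mul_right h2 (by positivity)
  -- `c`, `α` and `r` do not depend on `M`, so `M` can be sent to infinity.
  have hlim : Tendsto (fun M : ℝ => (∏ i : Fin k, r (k - i) + k.factorial / M) ^ 2) atTop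
      (𝓝 ((∏ i : Fin k, r (k - i) + 0) ^ 2)) :=
    ((tendsto_const_nhds.add (tendsto_const_nhds.div_atTop tendsto_id)).pow 2)
  rw [add_zero] at hlim
  exact ge_of_tendsto hlim ((eventually_ge_atTop 1).mono main)

/-- The quantitative lower bound on the approximation factor of core-sets of size `k ^ β`. -/
lemma pow_le_of_isComposableCoreset {d k : ℕ} (hk : 2 ≤ k) (hkd : k ≤ d) {β : ℝ} (hβ : 1 ≤ β)
    {c : Finset (EuclideanSpace ℝ (Fin d)) → Finset (EuclideanSpace ℝ (Fin d))} {α : ℝ}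
    (hc : IsComposableCoreset (detMaxValue k) α c) (hct : CoresetSizeLE c ((k : ℝ) ^ β)) :
    ((k / β) / (6 * Real.exp 1 * Real.log k)) ^ k ≤ α := by
  have hk2 : (2 : ℝ) ≤ k := by exact_mod_cast hk
  have hk0 : (0 : ℝ) < k := by linarith
  have hL : 0 < Real.log k := Real.log_pos (by linarith)
  have hα : 0 < α := hc.1
  -- The constant `6` makes `exp (n * r n ^ 2 / 2) = k ^ (3 * β)`, which exceeds `2 * k ^ β` because
  -- `k ^ β ≥ 2`.
  set q : ℝ := 6 * β * Real.log k with hq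
  have hq0 : 0 < q := by positivity
  let r : ℕ → ℝ := fun n => min 1 √(q / n)
  have hr : ∀ n, 0 ≤ r n := fun n => le_min zero_le_one (Real.sqrt_nonneg _)
  have ht : ∀ n : ℕ, 0 < n → 1 ≤ r n ∨ 2 * (k : ℝ) ^ β < Real.exp (n * r n ^ 2 / 2) := by
    intro n hn
    have hn0 : (0 : ℝ) < n := by exact_mod_cast hn
    rcases le_total 1 √(q / n) with h | h
    · left; exact le_min le_rfl h
    · right
      have h1 : (n : ℝ) * r n ^ 2 / 2 = Real.log k * β + Real.log k * β + Real.log k * β := by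
        simp only [r, min_eq_right h]
        rw [Real.sq_sqrt (by positivity)]
        field_simp
        rw [hq]; ring
      have h2 : (k : ℝ) ≤ (k : ℝ) ^ β := Real.self_le_rpow_of_one_le (by linarith) hβ
      rw [h1, Real.exp_add, Real.exp_add, ← Real.rpow_def_of_pos hk0]
      have h3 : (2 : ℝ) ≤ (k : ℝ) ^ β := hk2.trans h2
      have h4 : 4 ≤ (k : ℝ) ^ β * (k : ℝ) ^ β := by nlinarith
      nlinarith
  have hmain := one_div_le_prod_sq hkd hc hct hr (fun n => min_le_left _ _) ht
  have hprod : (∏ i : Fin k, r (k - i)) ^ 2 ≤ q ^ k / k.factorial := by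
    rw [← Finset.prod_pow]
    calc ∏ i : Fin k, r (k - i) ^ 2 ≤ ∏ i : Fin k, q / ((k - i : ℕ) : ℝ) := by
          refine Finset.prod_le_prod (fun _ _ => sq_nonneg _) fun i _ => ?_
          calc r (k - i) ^ 2 ≤ √(q / ((k - i : ℕ) : ℝ)) ^ 2 :=
                pow_le_pow_left₀ (hr _) (min_le_right _ _) 2
            _ = _ := Real.sq_sqrt (by positivity)
      _ = q ^ k / k.factorial := by
          rw [Finset.prod_div_distrib, Finset.prod_const, Finset.card_univ, Fintype.card_fin,
            Fin.prod_univ_eq_prod_range (fun i => ((k - i : ℕ) : ℝ)) k, ← Nat.cast_prod,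
            ← Nat.descFactorial_eq_prod_range, Nat.descFactorial_self]
  have hfact : (k : ℝ) ^ k / k.factorial ≤ Real.exp 1 ^ k := by
    rw [← Real.exp_nat_mul, mul_one]
    exact Real.pow_div_factorial_le_exp _ hk0.le k
  have hf0 : (0 : ℝ) < k.factorial := by exact_mod_cast k.factorial_pos
  have h1 : (k.factorial : ℝ) ≤ α * q ^ k := by
    have := hmain.trans hprod
    rw [div_le_div_iff₀ hα hf0] at this
    linarith
  have h2 : (k : ℝ) ^ k ≤ α * (Real.exp 1 * q) ^ k := by
    rw [div_le_iff₀ hf0] at hfact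
    calc (k : ℝ) ^ k ≤ Real.exp 1 ^ k * k.factorial := hfact
      _ ≤ Real.exp 1 ^ k * (α * q ^ k) := by gcongr
      _ = _ := by rw [mul_pow]; ring
  have h3 : ((k : ℝ) / β) / (6 * Real.exp 1 * Real.log k) = k / (Real.exp 1 * q) := by
    rw [div_div, hq]
    congr 1
    ring
  rw [h3, div_pow, div_le_iff₀ (by positivity)]
  exact h2

lemma one_le_of_isComposableCoreset {d k : ℕ} (hkd : k ≤ d)
    {c : Finset (EuclideanSpace ℝ (Fin d)) → Finset (EuclideanSpace ℝ (Fin d))} {α t : ℝ}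
    (hc : IsComposableCoreset (detMaxValue k) α c) (hct : CoresetSizeLE c t) : 1 ≤ α := by
  have h := one_div_le_prod_sq hkd hc hct (r := fun _ => 1) (fun _ => zero_le_one)
    (fun _ => le_rfl) (fun _ _ => Or.inl le_rfl)
  simp only [Finset.prod_const_one, one_pow] at h
  rwa [div_le_one hc.1] at h

/-! ### The error term and the conclusion -/

/-- The error term in the exponent of the lower bound. -/
noncomputable def coresetError (β : ℝ) (k : ℕ) : ℝ :=
  -- Chosen so that `(k / β) ^ ε = 6 * e * log k`; the value `1` makes the exponent vanish, leaving
  -- only `1 ≤ α` to prove.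
  if 2 ≤ k ∧ β < k then Real.log (6 * Real.exp 1 * Real.log k) / Real.log (k / β) else 1

lemma one_le_six_exp_log {k : ℕ} (hk : 2 ≤ k) : 1 ≤ 6 * Real.exp 1 * Real.log k := by
  have h1 : Real.log 2 ≤ Real.log k := Real.log_le_log (by norm_num) (by exact_mod_cast hk)
  have h2 := Real.log_two_gt_d9
  have h3 := Real.exp_one_gt_d9
  nlinarith

lemma eventually_abs_coresetError_le {η δ : ℝ} (hη : 0 < η) (hδ : 0 < δ) :
    ∀ᶠ k : ℕ in atTop, ∀ β : ℝ, 1 ≤ β → β ≤ (k : ℝ) ^ (1 - η) → |coresetError β k| ≤ δ := by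
  have hC : (0 : ℝ) < 6 * Real.exp 1 := by positivity
  have hlog : Tendsto (fun k : ℕ => 6 * Real.exp 1 * Real.log k) atTop atTop :=
    (Real.tendsto_log_atTop.comp tendsto_natCast_atTop_atTop).const_mul_atTop hC
  -- Uses `log x = o(x)` at `x = 6 * e * log k`, with the constant chosen to give `log x ≤ δ * η *
  -- log k`.
  have hb := hlog.eventually
    (Real.isLittleO_log_id_atTop.bound (c := δ * η / (6 * Real.exp 1)) (by positivity))
  filter_upwards [hb, eventually_ge_atTop 2] with k hk hk2 β hβ hβk
  have hk2' : (2 : ℝ) ≤ k := by exact_mod_cast hk2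
  have hk0 : (0 : ℝ) < k := by linarith
  have hL : 0 < Real.log k := Real.log_pos (by linarith)
  have hβ0 : 0 < β := by linarith
  have hD := one_le_six_exp_log hk2
  have hx : (k : ℝ) ^ η ≤ k / β := by
    rw [le_div_iff₀ hβ0]
    calc (k : ℝ) ^ η * β ≤ (k : ℝ) ^ η * (k : ℝ) ^ (1 - η) := by gcongr
      _ = k := by rw [← Real.rpow_add hk0]; simp
  have hlogx : η * Real.log k ≤ Real.log (k / β) := by
    rw [← Real.log_rpow hk0]
    exact Real.log_le_log (by positivity) hx
  have hβlt : β < k := by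
    have h1 : 1 < (k : ℝ) ^ η := Real.one_lt_rpow (by linarith) hη
    exact (one_lt_div hβ0).1 (h1.trans_le hx)
  have hpos : 0 < η * Real.log k := by positivity
  rw [coresetError, if_pos ⟨hk2, hβlt⟩,
    abs_of_nonneg (div_nonneg (Real.log_nonneg hD) (hpos.trans_le hlogx).le),
    div_le_iff₀ (hpos.trans_le hlogx)]
  rw [id, Real.norm_of_nonneg (Real.log_nonneg hD), Real.norm_of_nonneg (by linarith)] at hk
  calc Real.log (6 * Real.exp 1 * Real.log k)
      ≤ δ * η / (6 * Real.exp 1) * (6 * Real.exp 1 * Real.log k) := hk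
    _ = δ * (η * Real.log k) := by field_simp
    _ ≤ δ * Real.log (k / β) := by gcongr

lemma tendsto_coresetError (β : ℝ) (hβ : 1 ≤ β) : Tendsto (coresetError β) atTop (𝓝 0) := by
  rw [Metric.tendsto_atTop']
  intro δ hδ
  -- A fixed `β` is eventually at most `√k`, so the uniform bound applies; `δ / 2` gives the strict
  -- inequality.
  have h1 := eventually_abs_coresetError_le (η := 1 / 2) (by norm_num) (half_pos hδ)
  have h2 : ∀ᶠ k : ℕ in atTop, β ≤ (k : ℝ) ^ (1 - 1 / 2 : ℝ) :=
    ((tendsto_rpow_atTop (by norm_num)).comp tendsto_natCast_atTop_atTop).eventually_ge_atTop β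
  obtain ⟨N, hN⟩ := eventually_atTop.1 (h1.and h2)
  refine ⟨N, fun k hk => ?_⟩
  rw [Real.dist_0_eq_abs]
  have := (hN k hk.le).1 β hβ (hN k hk.le).2
  linarith

theorem mainTheorem4 :
    ∃ ε : ℝ → ℕ → ℝ,
      -- `ε β k = o(1)` as `k → ∞` for each fixed `β ≥ 1`, ...
      (∀ β : ℝ, 1 ≤ β → Tendsto (ε β) atTop (𝓝 0)) ∧
      -- ... and even uniformly in `1 ≤ β ≤ k ^ (1 - η)`, for each fixed `η > 0`
      (∀ η : ℝ, 0 < η → ∀ δ : ℝ, 0 < δ → ∀ᶠ k : ℕ in atTop,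
        ∀ β : ℝ, 1 ≤ β → β ≤ (k : ℝ) ^ (1 - η) → |ε β k| ≤ δ) ∧
      ∀ (β : ℝ), 1 ≤ β → ∀ (k : ℕ), 1 ≤ k → ∀ (d : ℕ), k ≤ d →
        ∀ (c : Finset (EuclideanSpace ℝ (Fin d)) → Finset (EuclideanSpace ℝ (Fin d))) (α : ℝ),
          IsComposableCoreset (detMaxValue k) α c →
          CoresetSizeLE c ((k : ℝ) ^ β) →
          ((k : ℝ) / β) ^ ((k : ℝ) * (1 - ε β k)) ≤ α := by
  refine ⟨coresetError, tendsto_coresetError,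
    fun η hη δ hδ => eventually_abs_coresetError_le hη hδ, ?_⟩
  intro β hβ k _ d hkd c α hc hct
  by_cases h : 2 ≤ k ∧ β < k
  · have hβ0 : 0 < β := by linarith
    have hx1 : 1 < (k : ℝ) / β := (one_lt_div hβ0).2 h.2
    have hx0 : 0 < (k : ℝ) / β := by linarith
    have hD := one_le_six_exp_log h.1
    have hlogx : Real.log (k / β) ≠ 0 := (Real.log_pos hx1).ne'
    rw [coresetError, if_pos h, mul_comm, Real.rpow_mul hx0.le, Real.rpow_natCast,
      Real.rpow_sub hx0, Real.rpow_one]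
    have hpow : ((k : ℝ) / β) ^ (Real.log (6 * Real.exp 1 * Real.log k) / Real.log (k / β))
        = 6 * Real.exp 1 * Real.log k := by
      rw [Real.rpow_def_of_pos hx0, mul_div_cancel₀ _ hlogx, Real.exp_log (by linarith)]
    rw [hpow]
    exact pow_le_of_isComposableCoreset h.1 hkd hβ hc hct
  · rw [coresetError, if_neg h]
    simpa using one_le_of_isComposableCoreset hkd hc hct
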